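/- Let $(\mathbb F_1,\mathbb F_2)$ be one of $(\mathbb R,\mathbb R)$, $(\mathbb C,\mathbb C)$, $(\mathbb C,\mathbb R)$, and let $G$ be a (discrete) group. A unital $\mathbb F_1$-operator space is an $\mathbb F_1$-linear subspace $X\subseteq B(H)$ with $1\in X$, where $H$ is a Hilbert space over $\mathbb F_1$; it is an $\mathbb F_1$-operator system if moreover $X=X^\star:=\{x^*:x\in X\}$. A unital $\mathbb F_1$-$G$-operator space (resp. $\mathbb F_1$-$G$-operator system) is a unital $\mathbb F_1$-operator space (resp. $\mathbb F_1$-operator system) on which $G$ acts by unital surjective $\mathbb F_1$-linear complete isometries (resp. unital $\mathbb F_1$-linear complete order isomorphisms). Let $\mathsf{OSp}^{\mathbb 1}_{(\mathbb F_1,\mathbb F_2)}$ be the category of unital $\mathbb F_1$-operator spaces and unital completely contractive $\mathbb F_2$-linear maps, $\mathsf{OSy}_{(\mathbb F_1,\mathbb F_2)}$ the category of $\mathbb F_1$-operator systems and unital completely positive $\mathbb F_2$-linear maps, and let $\mathsf{OSp}^{\mathbb 1,G}_{(\mathbb F_1,\mathbb F_2)}$, $\mathsf{OSy}^{G}_{(\mathbb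 F_1,\mathbb F_2)}$ be the corresponding categories of $G$-objects with $G$-equivariant morphisms. The Arveson functor $$\mathcal F_A:\mathsf{OSp}^{\mathbb 1}_{(\mathbb F_1,\mathbb F_2)}\to\mathsf{OSy}_{(\mathbb F_1,\mathbb F_2)},\qquad \mathcal F_A:\mathsf{OSp}^{\mathbb 1,G}_{(\mathbb F_1,\mathbb F_2)}\to\mathsf{OSy}^{G}_{(\mathbb F_1,\mathbb F_2)}$$ sends $X\subseteq B(H)$ to $X+X^\star\subseteq B(H)$ (with the action $g(x+y^*)=gx+(gy)^*$ in the $G$-case) and a morphism $u:X\to Y$ to $\tilde u:X+X^\star\to Y+Y^\star$, $\tilde u(x+y^*)=u(x)+u(y)^*$. In all six cases, $\mathcal F_A$ is faithful, not full, and essentially surjective. Non-fullness is witnessed as follows. Let $\mathcal T_2\subseteq M_2(\mathbb F_1)=B(\mathbb F_1^2)$ be the space of upper triangular matrices (with the trivial $G$-action in the $G$-case). Then $\mathcal T_2+\mathcal T_2^\star=M_2(\mathbb F_1)$; the flip $*$-automorphism $$\begin{bmatrix}a_{11}&a_{12}\\a_{21}&a_{22}\end{bmatrix}\mapsto\begin{bmatrix}0&1\\1&0\end{bmatrix}\begin{bmatrix}a_{11}&a_{12}\\a_{21}&a_{22}\end{bmatrix}\begin{bmatrix}0&1\\1&0\end{bmatrix}=\begin{bmatrix}a_{22}&a_{21}\\a_{12}&a_{11}\end{bmatrix}$$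 of $M_2(\mathbb F_1)$ does not map $\mathcal T_2$ into itself; and it is a morphism $\mathcal F_A(\mathcal T_2)\to\mathcal F_A(\mathcal T_2)$ which is not of the form $\mathcal F_A(f)$ for any morphism $f:\mathcal T_2\to\mathcal T_2$. -/

import Mathlib

open CategoryTheory

universe u v

noncomputable section

namespace OperatorCat

section Matrices

variable {𝕜 : Type} [RCLike 𝕜] {H : Type u} [NormedAddCommGroup H] [InnerProductSpace 𝕜 H]

/-- The canonical identification `M_n(B(H)) ≅ B(Hⁿ)`, where `Hⁿ` is the `ℓ²`-direct sum:
`(matrixOp a ξ)_i = ∑_j a_{ij} ξ_j`. -/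
def matrixOp {n : ℕ} (a : Matrix (Fin n) (Fin n) (H →L[𝕜] H)) :
    PiLp 2 (fun _ : Fin n => H) →L[𝕜] PiLp 2 (fun _ : Fin n => H) :=
  ((PiLp.continuousLinearEquiv 2 𝕜 (fun _ : Fin n => H)).symm : _ →L[𝕜] _) ∘L
    ContinuousLinearMap.pi (fun i => ∑ j, a i j ∘L PiLp.proj 2 (fun _ : Fin n => H) j)

theorem matrixOp_apply {n : ℕ} (a : Matrix (Fin n) (Fin n) (H →L[𝕜] H))
    (ξ : PiLp 2 (fun _ : Fin n => H)) (i : Fin n) :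
    matrixOp a ξ i = ∑ j, a i j (ξ j) := by
  simp [matrixOp]

theorem inner_matrixOp {n : ℕ} (a : Matrix (Fin n) (Fin n) (H →L[𝕜] H))
    (ξ η : PiLp 2 (fun _ : Fin n => H)) :
    inner 𝕜 (matrixOp a ξ) η = ∑ i, ∑ j, inner 𝕜 (a i j (ξ j)) (η i) := by
  simp [PiLp.inner_apply, matrixOp_apply, sum_inner]

theorem inner_matrixOp_single {n : ℕ} (a : Matrix (Fin n) (Fin n) (H →L[𝕜] H))
    (i j : Fin n) (v w : H) :
    inner 𝕜 (matrixOp a (WithLp.toLp 2 (Pi.single j v))) (WithLp.toLp 2 (Pi.single i w)) =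
      inner 𝕜 (a i j v) w := by
  rw [inner_matrixOp, Finset.sum_eq_single i, Finset.sum_eq_single j]
  · simp
  · intro k _ hk; simp [hk]
  · simp
  · intro k _ hk; simp [hk]
  · simp

theorem isSymmetric_matrixOp_iff [CompleteSpace H] {n : ℕ}
    (a : Matrix (Fin n) (Fin n) (H →L[𝕜] H)) :
    (matrixOp a).IsSymmetric ↔ ∀ i j, star (a i j) = a j i := by
  constructor
  · intro h i j
    rw [ContinuousLinearMap.star_eq_adjoint]
    refine ContinuousLinearMap.ext fun w => ext_inner_right 𝕜 fun v => ?_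
    have := h (WithLp.toLp 2 (Pi.single i w)) (WithLp.toLp 2 (Pi.single j v))
    simp only [ContinuousLinearMap.coe_coe] at this
    rw [inner_matrixOp_single] at this
    rw [ContinuousLinearMap.adjoint_inner_left, this, ← inner_conj_symm]
    exact (congrArg _ (inner_matrixOp_single a i j v w).symm).trans (inner_conj_symm _ _)
  · intro h ξ η
    simp only [ContinuousLinearMap.coe_coe]
    rw [← inner_conj_symm ξ, inner_matrixOp, inner_matrixOp, map_sum, Finset.sum_comm]
    refine Finset.sum_congr rfl fun i _ => ?_
    rw [map_sum]
    refine Finset.sum_congr rfl fun j _ => ?_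
    rw [inner_conj_symm, ← h i j, ContinuousLinearMap.star_eq_adjoint,
      ContinuousLinearMap.adjoint_inner_left]

theorem norm_natCast_sub_apply_sq {K : Type*} [NormedAddCommGroup K] [InnerProductSpace 𝕜 K]
    (T : K →L[𝕜] K) (m : ℕ) (ξ : K) :
    ‖((m : 𝕜) • (1 : K →L[𝕜] K) - T) ξ‖ ^ 2 =
      (m : ℝ) ^ 2 * ‖ξ‖ ^ 2 - 2 * m * RCLike.re (inner 𝕜 (T ξ) ξ) + ‖T ξ‖ ^ 2 := by
  have h : ((m : 𝕜) • (1 : K →L[𝕜] K) - T) ξ = (m : 𝕜) • ξ - T ξ := rfl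
  have h' : ∀ z : 𝕜, RCLike.re ((m : 𝕜) * z) = m * RCLike.re z := fun z => by
    rw [← RCLike.ofReal_natCast, RCLike.re_ofReal_mul]
  rw [h, @norm_sub_sq 𝕜, norm_smul, inner_smul_left, RCLike.norm_natCast, map_natCast,
    h', inner_re_symm]
  ring

theorem accretive_of_norm_le {E F : Type*} [NormedAddCommGroup E] [InnerProductSpace 𝕜 E]
    [NormedAddCommGroup F] [InnerProductSpace 𝕜 F] (A : E →L[𝕜] E) (B : F →L[𝕜] F)
    (h : ∀ m : ℕ, ‖(m : 𝕜) • (1 : F →L[𝕜] F) - B‖ ≤ ‖(m : 𝕜) • (1 : E →L[𝕜] E) - A‖)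
    (hA : ∀ ξ, 0 ≤ RCLike.re (inner 𝕜 (A ξ) ξ)) (η : F) :
    0 ≤ RCLike.re (inner 𝕜 (B η) η) := by
  have bound : ∀ m : ℕ, ‖(m : 𝕜) • (1 : E →L[𝕜] E) - A‖ ^ 2 ≤ (m : ℝ) ^ 2 + ‖A‖ ^ 2 := by
    intro m
    have h0 : (0 : ℝ) ≤ (m : ℝ) ^ 2 + ‖A‖ ^ 2 := by positivity
    have : ‖(m : 𝕜) • (1 : E →L[𝕜] E) - A‖ ≤ Real.sqrt ((m : ℝ) ^ 2 + ‖A‖ ^ 2) := by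
      refine ContinuousLinearMap.opNorm_le_bound _ (Real.sqrt_nonneg _) fun ξ => ?_
      refine abs_le_of_sq_le_sq' ?_ (by positivity) |>.2
      rw [norm_natCast_sub_apply_sq, mul_pow, Real.sq_sqrt h0]
      have h1 : ‖A ξ‖ ^ 2 ≤ (‖A‖ * ‖ξ‖) ^ 2 := by
        gcongr
        exact A.le_opNorm ξ
      have h2 : 0 ≤ 2 * (m : ℝ) * RCLike.re (inner 𝕜 (A ξ) ξ) :=
        mul_nonneg (by positivity) (hA ξ)
      nlinarith
    calc _ ≤ Real.sqrt ((m : ℝ) ^ 2 + ‖A‖ ^ 2) ^ 2 := by gcongr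
      _ = _ := Real.sq_sqrt h0
  by_contra! hneg
  obtain ⟨m, hm⟩ := exists_nat_gt (‖A‖ ^ 2 * ‖η‖ ^ 2 / (-2 * RCLike.re (inner 𝕜 (B η) η)))
  rw [div_lt_iff₀ (by linarith)] at hm
  have h1 : ‖((m : 𝕜) • (1 : F →L[𝕜] F) - B) η‖ ^ 2 ≤
      (‖(m : 𝕜) • (1 : F →L[𝕜] F) - B‖ * ‖η‖) ^ 2 := by
    gcongr
    exact ContinuousLinearMap.le_opNorm _ η
  have h2 : ‖(m : 𝕜) • (1 : F →L[𝕜] F) - B‖ ^ 2 ≤ (m : ℝ) ^ 2 + ‖A‖ ^ 2 :=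
    le_trans (by gcongr; exact h m) (bound m)
  rw [norm_natCast_sub_apply_sq, mul_pow] at h1
  have h3 := mul_le_mul_of_nonneg_right h2 (sq_nonneg ‖η‖)
  nlinarith [sq_nonneg ‖B η‖]

end Matrices

/-- An operator space over `𝕜`: a linear subspace of `B(H)` for a Hilbert space `H` over `𝕜`. -/
structure OperatorSpace (𝕜 : Type) [RCLike 𝕜] : Type (u + 1) where
  H : Type u
  [normed : NormedAddCommGroup H]
  [innerProduct : InnerProductSpace 𝕜 H]
  [complete : CompleteSpace H]
  space : Submodule 𝕜 (H →L[𝕜] H)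

attribute [instance] OperatorSpace.normed OperatorSpace.innerProduct OperatorSpace.complete

/-- A unital operator space: an operator space in `B(H)` which contains the identity operator. -/
structure UnitalOperatorSpace (𝕜 : Type) [RCLike 𝕜] : Type (u + 1)
    extends OperatorSpace.{u} 𝕜 where
  one_mem : (1 : H →L[𝕜] H) ∈ space

/-- An operator system: a unital operator space which is closed under adjoints. -/
structure OperatorSystem (𝕜 : Type) [RCLike 𝕜] : Type (u + 1)
    extends UnitalOperatorSpace.{u} 𝕜 where
  star_mem : ∀ x ∈ space, star x ∈ space

section Maps

variable {𝕜 : Type} [RCLike 𝕜]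

/-- The unit of a unital operator space, as an element of the space. -/
def UnitalOperatorSpace.unit (X : UnitalOperatorSpace.{u} 𝕜) : X.space := ⟨1, X.one_mem⟩

/-- The inclusion `M_n(X) ⊆ M_n(B(H)) = B(Hⁿ)`. -/
def OperatorSpace.amp (X : OperatorSpace.{u} 𝕜) {n : ℕ} (a : Matrix (Fin n) (Fin n) X.space) :
    PiLp 2 (fun _ : Fin n => X.H) →L[𝕜] PiLp 2 (fun _ : Fin n => X.H) :=
  matrixOp (a.map fun x => (x : X.H →L[𝕜] X.H))

/-- `‖f_n(a)‖ ≤ ‖a‖` for all `n` and all `a ∈ M_n(X)`, where `f_n` applies `f` entrywise. -/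
def IsCompletelyContractive {X Y : OperatorSpace.{u} 𝕜} (f : X.space → Y.space) : Prop :=
  ∀ (n : ℕ) (a : Matrix (Fin n) (Fin n) X.space), ‖Y.amp (a.map f)‖ ≤ ‖X.amp a‖

/-- `‖f_n(a)‖ = ‖a‖` for all `n` and all `a ∈ M_n(X)`. -/
def IsCompletelyIsometric {X Y : OperatorSpace.{u} 𝕜} (f : X.space → Y.space) : Prop :=
  ∀ (n : ℕ) (a : Matrix (Fin n) (Fin n) X.space), ‖Y.amp (a.map f)‖ = ‖X.amp a‖

/-- `f_n(a) ≥ 0` for all `n` and all `a ≥ 0` in `M_n(X)`. -/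
def IsCompletelyPositive {X Y : OperatorSpace.{u} 𝕜} (f : X.space → Y.space) : Prop :=
  ∀ (n : ℕ) (a : Matrix (Fin n) (Fin n) X.space),
    (X.amp a).IsPositive → (Y.amp (a.map f)).IsPositive

/-- `f_n(a) ≥ 0` if and only if `a ≥ 0`, for all `n` and all `a ∈ M_n(X)`. -/
def IsCompleteOrderEmbedding {X Y : OperatorSpace.{u} 𝕜} (f : X.space → Y.space) : Prop :=
  ∀ (n : ℕ) (a : Matrix (Fin n) (Fin n) X.space),
    (X.amp a).IsPositive ↔ (Y.amp (a.map f)).IsPositive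

end Maps

/-- A unital `G`-operator space: `G` acts by linear unital surjective complete isometries. -/
structure GUnitalOperatorSpace (𝕜 : Type) [RCLike 𝕜] (G : Type v) [Group G] :
    Type (max (u + 1) v) extends UnitalOperatorSpace.{u} 𝕜 where
  action : G →* (space ≃ₗ[𝕜] space)
  action_unit : ∀ g, action g toUnitalOperatorSpace.unit = toUnitalOperatorSpace.unit
  action_isometric : ∀ g,
    IsCompletelyIsometric (X := toOperatorSpace) (Y := toOperatorSpace) (action g)

/-- A `G`-operator system: `G` acts by linear unital complete order isomorphisms. -/
structure GOperatorSystem (𝕜 : Type) [RCLike 𝕜] (G : Type v) [Group G] :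
    Type (max (u + 1) v) extends OperatorSystem.{u} 𝕜 where
  action : G →* (space ≃ₗ[𝕜] space)
  action_unit : ∀ g, action g toUnitalOperatorSpace.unit = toUnitalOperatorSpace.unit
  action_order : ∀ g,
    IsCompleteOrderEmbedding (X := toOperatorSpace) (Y := toOperatorSpace) (action g)

section Morphisms

variable {𝕜₁ : Type} (𝕜₂ : Type) [RCLike 𝕜₁] [RCLike 𝕜₂] [Algebra 𝕜₂ 𝕜₁]

/-- Unital completely contractive `𝕜₂`-linear maps between unital `𝕜₁`-operator spaces. -/
@[ext]
structure UCCMap (X Y : UnitalOperatorSpace.{u} 𝕜₁) where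
  toFun : X.space →+ Y.space
  map_smul : ∀ (c : 𝕜₂) (x : X.space),
    toFun (algebraMap 𝕜₂ 𝕜₁ c • x) = algebraMap 𝕜₂ 𝕜₁ c • toFun x
  map_unit : toFun X.unit = Y.unit
  contractive : IsCompletelyContractive (X := X.toOperatorSpace) (Y := Y.toOperatorSpace) toFun

/-- Unital completely positive `𝕜₂`-linear maps between `𝕜₁`-operator systems. -/
@[ext]
structure UCPMap (X Y : OperatorSystem.{u} 𝕜₁) where
  toFun : X.space →+ Y.space
  map_smul : ∀ (c : 𝕜₂) (x : X.space),
    toFun (algebraMap 𝕜₂ 𝕜₁ c • x) = algebraMap 𝕜₂ 𝕜₁ c • toFun x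
  map_unit : toFun X.unit = Y.unit
  positive : IsCompletelyPositive (X := X.toOperatorSpace) (Y := Y.toOperatorSpace) toFun

/-- Equivariant unital completely contractive `𝕜₂`-linear maps. -/
@[ext]
structure GUCCMap {G : Type v} [Group G] (X Y : GUnitalOperatorSpace.{u} 𝕜₁ G) extends
    UCCMap 𝕜₂ X.toUnitalOperatorSpace Y.toUnitalOperatorSpace where
  equivariant : ∀ (g : G) (x : X.space), toFun (X.action g x) = Y.action g (toFun x)

/-- Equivariant unital completely positive `𝕜₂`-linear maps. -/
@[ext]
structure GUCPMap {G : Type v} [Group G] (X Y : GOperatorSystem.{u} 𝕜₁ G) extends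
    UCPMap 𝕜₂ X.toOperatorSystem Y.toOperatorSystem where
  equivariant : ∀ (g : G) (x : X.space), toFun (X.action g x) = Y.action g (toFun x)

variable {𝕜₂}

/-- The identity map. -/
def UCCMap.id (X : UnitalOperatorSpace.{u} 𝕜₁) : UCCMap 𝕜₂ X X where
  toFun := AddMonoidHom.id _
  map_smul _ _ := rfl
  map_unit := rfl
  contractive _ _ := le_rfl

/-- Composition (first `f`, then `g`). -/
def UCCMap.comp {X Y Z : UnitalOperatorSpace.{u} 𝕜₁} (f : UCCMap 𝕜₂ X Y) (g : UCCMap 𝕜₂ Y Z) :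
    UCCMap 𝕜₂ X Z where
  toFun := g.toFun.comp f.toFun
  map_smul c x := by simp [f.map_smul, g.map_smul]
  map_unit := by simp [f.map_unit, g.map_unit]
  contractive n a := (g.contractive n (a.map f.toFun)).trans (f.contractive n a)

/-- The identity map. -/
def UCPMap.id (X : OperatorSystem.{u} 𝕜₁) : UCPMap 𝕜₂ X X where
  toFun := AddMonoidHom.id _
  map_smul _ _ := rfl
  map_unit := rfl
  positive _ _ h := h

/-- Composition (first `f`, then `g`). -/
def UCPMap.comp {X Y Z : OperatorSystem.{u} 𝕜₁} (f : UCPMap 𝕜₂ X Y) (g : UCPMap 𝕜₂ Y Z) :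
    UCPMap 𝕜₂ X Z where
  toFun := g.toFun.comp f.toFun
  map_smul c x := by simp [f.map_smul, g.map_smul]
  map_unit := by simp [f.map_unit, g.map_unit]
  positive n a h := g.positive n (a.map f.toFun) (f.positive n a h)

/-- The identity map. -/
def GUCCMap.id {G : Type v} [Group G] (X : GUnitalOperatorSpace.{u} 𝕜₁ G) : GUCCMap 𝕜₂ X X where
  toUCCMap := UCCMap.id _
  equivariant _ _ := rfl

/-- Composition (first `f`, then `g`). -/
def GUCCMap.comp {G : Type v} [Group G] {X Y Z : GUnitalOperatorSpace.{u} 𝕜₁ G}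
    (f : GUCCMap 𝕜₂ X Y) (g : GUCCMap 𝕜₂ Y Z) : GUCCMap 𝕜₂ X Z where
  toUCCMap := f.toUCCMap.comp g.toUCCMap
  equivariant k x := (congrArg g.toFun (f.equivariant k x)).trans (g.equivariant k _)

/-- The identity map. -/
def GUCPMap.id {G : Type v} [Group G] (X : GOperatorSystem.{u} 𝕜₁ G) : GUCPMap 𝕜₂ X X where
  toUCPMap := UCPMap.id _
  equivariant _ _ := rfl

/-- Composition (first `f`, then `g`). -/
def GUCPMap.comp {G : Type v} [Group G] {X Y Z : GOperatorSystem.{u} 𝕜₁ G}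
    (f : GUCPMap 𝕜₂ X Y) (g : GUCPMap 𝕜₂ Y Z) : GUCPMap 𝕜₂ X Z where
  toUCPMap := f.toUCPMap.comp g.toUCPMap
  equivariant k x := (congrArg g.toFun (f.equivariant k x)).trans (g.equivariant k _)

end Morphisms

section Categories

/-- The objects of the category of unital `𝕜₁`-operator spaces and unital completely contractive
`𝕜₂`-linear maps (`𝕜₂` enters only through the morphisms). -/
@[nolint unusedArguments]
def OSpOne (𝕜₁ 𝕜₂ : Type) [RCLike 𝕜₁] [RCLike 𝕜₂] [Algebra 𝕜₂ 𝕜₁] : Type (u + 1) :=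
  UnitalOperatorSpace.{u} 𝕜₁

/-- The objects of the category of `𝕜₁`-operator systems and unital completely positive
`𝕜₂`-linear maps. -/
@[nolint unusedArguments]
def OSy (𝕜₁ 𝕜₂ : Type) [RCLike 𝕜₁] [RCLike 𝕜₂] [Algebra 𝕜₂ 𝕜₁] : Type (u + 1) :=
  OperatorSystem.{u} 𝕜₁

/-- The objects of the category of unital `𝕜₁`-`G`-operator spaces and `G`-equivariant unital
completely contractive `𝕜₂`-linear maps. -/
@[nolint unusedArguments]
def OSpOneG (𝕜₁ 𝕜₂ : Type) [RCLike 𝕜₁] [RCLike 𝕜₂] [Algebra 𝕜₂ 𝕜₁]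
    (G : Type v) [Group G] : Type (max (u + 1) v) :=
  GUnitalOperatorSpace.{u} 𝕜₁ G

/-- The objects of the category of `𝕜₁`-`G`-operator systems and `G`-equivariant unital completely
positive `𝕜₂`-linear maps. -/
@[nolint unusedArguments]
def OSyG (𝕜₁ 𝕜₂ : Type) [RCLike 𝕜₁] [RCLike 𝕜₂] [Algebra 𝕜₂ 𝕜₁]
    (G : Type v) [Group G] : Type (max (u + 1) v) :=
  GOperatorSystem.{u} 𝕜₁ G

variable (𝕜₁ 𝕜₂ : Type) [RCLike 𝕜₁] [RCLike 𝕜₂] [Algebra 𝕜₂ 𝕜₁] (G : Type v) [Group G]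

instance : Category (OSpOne.{u} 𝕜₁ 𝕜₂) where
  Hom X Y := UCCMap 𝕜₂ X Y
  id X := UCCMap.id X
  comp f g := UCCMap.comp f g

instance : Category (OSy.{u} 𝕜₁ 𝕜₂) where
  Hom X Y := UCPMap 𝕜₂ X Y
  id X := UCPMap.id X
  comp f g := UCPMap.comp f g

instance : Category (OSpOneG.{u} 𝕜₁ 𝕜₂ G) where
  Hom X Y := GUCCMap 𝕜₂ X Y
  id X := GUCCMap.id X
  comp f g := GUCCMap.comp f g

instance : Category (OSyG.{u} 𝕜₁ 𝕜₂ G) where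
  Hom X Y := GUCPMap 𝕜₂ X Y
  id X := GUCPMap.id X
  comp f g := GUCPMap.comp f g

end Categories

section Arveson

variable {𝕜 : Type} [RCLike 𝕜]

/-- The subspace `X + X⋆ = {x + y⋆ : x, y ∈ X}` of `B(H)`. -/
def UnitalOperatorSpace.addStar (X : UnitalOperatorSpace.{u} 𝕜) :
    Submodule 𝕜 (X.H →L[𝕜] X.H) where
  carrier := {z | ∃ x ∈ X.space, ∃ y ∈ X.space, z = x + star y}
  zero_mem' := ⟨0, X.space.zero_mem, 0, X.space.zero_mem, by simp⟩
  add_mem' := by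
    rintro _ _ ⟨x, hx, y, hy, rfl⟩ ⟨x', hx', y', hy', rfl⟩
    exact ⟨x + x', X.space.add_mem hx hx', y + y', X.space.add_mem hy hy', by
      rw [star_add]; abel⟩
  smul_mem' := by
    rintro c _ ⟨x, hx, y, hy, rfl⟩
    exact ⟨c • x, X.space.smul_mem c hx, star c • y, X.space.smul_mem _ hy, by
      rw [star_smul, star_star, smul_add]⟩

/-- The operator system `X + X⋆` generated by a unital operator space `X`. -/
def UnitalOperatorSpace.arveson (X : UnitalOperatorSpace.{u} 𝕜) : OperatorSystem.{u} 𝕜 where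
  H := X.H
  space := X.addStar
  one_mem := ⟨1, X.one_mem, 0, X.space.zero_mem, by simp⟩
  star_mem := by
    rintro _ ⟨x, hx, y, hy, rfl⟩
    exact ⟨y, hy, x, hx, by rw [star_add, star_star, add_comm]⟩

variable {X Y Z : UnitalOperatorSpace.{u} 𝕜}

/-- The element `x + y⋆` of `X + X⋆`. -/
def addStarMk (x y : X.space) : X.arveson.space :=
  ⟨(x : X.H →L[𝕜] X.H) + star (y : X.H →L[𝕜] X.H), x, x.2, y, y.2, rfl⟩

theorem exists_mk (z : X.arveson.space) : ∃ x y : X.space, z = addStarMk x y := by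
  obtain ⟨z, x, hx, y, hy, rfl⟩ := z
  exact ⟨⟨x, hx⟩, ⟨y, hy⟩, rfl⟩

theorem accretive_map (f : X.space →+ Y.space) (h1 : f X.unit = Y.unit)
    (hf : IsCompletelyContractive (X := X.toOperatorSpace) (Y := Y.toOperatorSpace) f)
    {n : ℕ} (a : Matrix (Fin n) (Fin n) X.space)
    (ha : ∀ ξ, 0 ≤ RCLike.re (inner 𝕜 (X.amp a ξ) ξ)) (η : PiLp 2 (fun _ : Fin n => Y.H)) :
    0 ≤ RCLike.re (inner 𝕜 (Y.amp (a.map f) η) η) := by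
  refine accretive_of_norm_le (X.amp a) (Y.amp (a.map f)) (fun m => ?_) ha η
  have aux : ∀ (W : UnitalOperatorSpace.{u} 𝕜) (b : Matrix (Fin n) (Fin n) W.space),
      (m : 𝕜) • 1 - W.amp b =
        W.amp (Matrix.of fun i j => (if i = j then m • W.unit else 0) - b i j) := by
    intro W b
    ext ξ i
    have h : ((m : 𝕜) • 1 - W.amp b) ξ i = (m : 𝕜) • ξ i - W.amp b ξ i := rfl
    rw [h, OperatorSpace.amp, OperatorSpace.amp, matrixOp_apply, matrixOp_apply]
    simp only [Matrix.map_apply, Matrix.of_apply, Submodule.coe_sub, sub_apply,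
      Finset.sum_sub_distrib]
    congr 1
    rw [Finset.sum_eq_single i]
    · simp [UnitalOperatorSpace.unit, Nat.cast_smul_eq_nsmul]
    · intro j _ hj
      simp [Ne.symm hj]
    · simp
  rw [aux, aux]
  convert hf n _ using 3
  ext i j : 2
  simp only [Matrix.of_apply, Matrix.map_apply, map_sub]
  congr 1
  split_ifs
  · rw [map_nsmul, h1]
  · rw [map_zero]

theorem map_add_star_eq_zero (f : X.space →+ Y.space) (h1 : f X.unit = Y.unit)
    (hf : IsCompletelyContractive (X := X.toOperatorSpace) (Y := Y.toOperatorSpace) f)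
    (x y : X.space) (h : (x : X.H →L[𝕜] X.H) + star (y : X.H →L[𝕜] X.H) = 0) :
    (f x : Y.H →L[𝕜] Y.H) + star (f y : Y.H →L[𝕜] Y.H) = 0 := by
  have form : ∀ (W : UnitalOperatorSpace.{u} 𝕜) (p q : W.space)
      (ξ : PiLp 2 (fun _ : Fin 2 => W.H)),
      RCLike.re (inner 𝕜 (W.amp !![0, p; q, 0] ξ) ξ) =
        RCLike.re (inner 𝕜 (((p : W.H →L[𝕜] W.H) + star (q : W.H →L[𝕜] W.H)) (ξ 1)) (ξ 0)) := by
    intro W p q ξ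
    rw [OperatorSpace.amp, inner_matrixOp]
    simp [Fin.sum_univ_two, inner_add_left, ContinuousLinearMap.star_eq_adjoint,
      ContinuousLinearMap.adjoint_inner_left]
    rw [inner_re_symm]
  have pos : ∀ p q : X.space, (p : X.H →L[𝕜] X.H) + star (q : X.H →L[𝕜] X.H) = 0 →
      ∀ v w : Y.H, 0 ≤
        RCLike.re (inner 𝕜 (((f p : Y.H →L[𝕜] Y.H) + star (f q : Y.H →L[𝕜] Y.H)) v) w) := by
    intro p q hpq v w
    have := accretive_map f h1 hf !![0, p; q, 0] (fun ξ => by rw [form, hpq]; simp)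
      (WithLp.toLp 2 ![w, v])
    have e : (!![0, p; q, 0] : Matrix _ _ X.space).map f = !![0, f p; f q, 0] := by
      ext i j : 2
      fin_cases i <;> fin_cases j <;> simp
    rw [e, form] at this
    simpa using this
  refine ContinuousLinearMap.ext fun v => ?_
  have h2 := pos x y h v (-(((f x : Y.H →L[𝕜] Y.H) + star (f y : Y.H →L[𝕜] Y.H)) v))
  rw [inner_neg_right, inner_self_eq_norm_sq_to_K, map_neg] at h2
  norm_cast at h2
  have h3 : ‖((f x : Y.H →L[𝕜] Y.H) + star (f y : Y.H →L[𝕜] Y.H)) v‖ ^ 2 = 0 :=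
    le_antisymm (by simpa using h2) (sq_nonneg _)
  simpa using h3

/-- The map `x + y⋆ ↦ f x + (f y)⋆`. -/
def arvesonFun (f : X.space → Y.space) (z : X.arveson.space) : Y.arveson.space :=
  addStarMk (f (exists_mk z).choose) (f (exists_mk z).choose_spec.choose)

theorem arvesonFun_mk (f : X.space →+ Y.space) (h1 : f X.unit = Y.unit)
    (hf : IsCompletelyContractive (X := X.toOperatorSpace) (Y := Y.toOperatorSpace) f)
    (x y : X.space) :
    arvesonFun f (addStarMk x y) = addStarMk (f x) (f y) := by
  have h := (exists_mk (addStarMk x y)).choose_spec.choose_spec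
  rw [arvesonFun]
  set x' := (exists_mk (addStarMk x y)).choose
  set y' := (exists_mk (addStarMk x y)).choose_spec.choose
  have h' : (x : X.H →L[𝕜] X.H) + star (y : X.H →L[𝕜] X.H) =
    (x' : X.H →L[𝕜] X.H) + star (y' : X.H →L[𝕜] X.H) := congrArg Subtype.val h
  have h0 := map_add_star_eq_zero f h1 hf (x' - x) (y' - y) (by
    rw [Submodule.coe_sub, Submodule.coe_sub, star_sub]
    rw [sub_add_sub_comm, ← h', sub_self])
  rw [map_sub, map_sub, Submodule.coe_sub, Submodule.coe_sub, star_sub, sub_add_sub_comm,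
    sub_eq_zero] at h0
  refine Subtype.ext ?_
  show (f x' : Y.H →L[𝕜] Y.H) + star (f y' : Y.H →L[𝕜] Y.H) =
    (f x : Y.H →L[𝕜] Y.H) + star (f y : Y.H →L[𝕜] Y.H)
  exact h0

/-- The additive map `x + y⋆ ↦ f x + (f y)⋆`, for `f` unital and completely contractive. -/
def arvesonHom (f : X.space →+ Y.space) (h1 : f X.unit = Y.unit)
    (hf : IsCompletelyContractive (X := X.toOperatorSpace) (Y := Y.toOperatorSpace) f) :
    X.arveson.space →+ Y.arveson.space where
  toFun := arvesonFun f
  map_zero' := by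
    have h : (0 : X.arveson.space) = addStarMk 0 0 :=
      Subtype.ext (by simp [addStarMk]; rfl)
    rw [h, arvesonFun_mk f h1 hf]
    exact Subtype.ext (by simp [addStarMk]; rfl)
  map_add' z w := by
    obtain ⟨x, y, rfl⟩ := exists_mk z
    obtain ⟨x', y', rfl⟩ := exists_mk w
    have h : ∀ (W : UnitalOperatorSpace.{u} 𝕜) (a b c d : W.space),
        addStarMk a b + addStarMk c d =
          addStarMk (a + c) (b + d) := fun W a b c d =>
      Subtype.ext (by simp [addStarMk]; abel)
    rw [h, arvesonFun_mk f h1 hf, arvesonFun_mk f h1 hf, arvesonFun_mk f h1 hf, h, map_add,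
      map_add]

theorem arvesonHom_mk (f : X.space →+ Y.space) (h1 : f X.unit = Y.unit)
    (hf : IsCompletelyContractive (X := X.toOperatorSpace) (Y := Y.toOperatorSpace) f)
    (x y : X.space) :
    arvesonHom f h1 hf (addStarMk x y) = addStarMk (f x) (f y) :=
  arvesonFun_mk f h1 hf x y

theorem arvesonHom_unit (f : X.space →+ Y.space) (h1 : f X.unit = Y.unit)
    (hf : IsCompletelyContractive (X := X.toOperatorSpace) (Y := Y.toOperatorSpace) f) :
    arvesonHom f h1 hf X.arveson.unit = Y.arveson.unit := by
  have h : ∀ W : UnitalOperatorSpace.{u} 𝕜,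
      W.arveson.unit = addStarMk W.unit 0 := fun W =>
    Subtype.ext (by simp [addStarMk, UnitalOperatorSpace.unit]; rfl)
  rw [h, arvesonHom_mk, h1, map_zero, ← h]

theorem arvesonHom_smul (f : X.space →+ Y.space) (h1 : f X.unit = Y.unit)
    (hf : IsCompletelyContractive (X := X.toOperatorSpace) (Y := Y.toOperatorSpace) f)
    (c : 𝕜) (hc : ∀ x, f (c • x) = c • f x) (hc' : ∀ x, f (star c • x) = star c • f x)
    (z : X.arveson.space) : arvesonHom f h1 hf (c • z) = c • arvesonHom f h1 hf z := by
  obtain ⟨x, y, rfl⟩ := exists_mk z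
  have h : ∀ (W : UnitalOperatorSpace.{u} 𝕜) (a b : W.space),
      c • addStarMk a b = addStarMk (c • a) (star c • b) :=
    fun W a b => Subtype.ext (by
      simp only [addStarMk, Submodule.coe_smul, star_smul, star_star]
      exact smul_add _ _ _)
  rw [h, arvesonHom_mk, arvesonHom_mk, h, hc, hc']

theorem arvesonHom_positive (f : X.space →+ Y.space) (h1 : f X.unit = Y.unit)
    (hf : IsCompletelyContractive (X := X.toOperatorSpace) (Y := Y.toOperatorSpace) f) :
    IsCompletelyPositive (X := X.arveson.toOperatorSpace) (Y := Y.arveson.toOperatorSpace)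
      (arvesonHom f h1 hf) := by
  intro n a ha
  choose x y hxy using fun i j => exists_mk (a i j)
  have form : ∀ (W : UnitalOperatorSpace.{u} 𝕜) (p q : Fin n → Fin n → W.space)
      (ξ : PiLp 2 (fun _ : Fin n => W.H)),
      RCLike.re (inner 𝕜 (matrixOp (Matrix.of fun i j =>
        (p i j : W.H →L[𝕜] W.H) + star (q i j : W.H →L[𝕜] W.H)) ξ) ξ) =
      RCLike.re (inner 𝕜 (W.amp (Matrix.of fun i j => p i j + q j i) ξ) ξ) := by
    intro W p q ξ
    rw [OperatorSpace.amp, inner_matrixOp, inner_matrixOp]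
    simp only [Matrix.of_apply, Matrix.map_apply, Submodule.coe_add, add_apply,
      inner_add_left, Finset.sum_add_distrib, map_add]
    congr 1
    rw [Finset.sum_comm, map_sum, map_sum]
    refine Finset.sum_congr rfl fun i _ => ?_
    rw [map_sum, map_sum]
    refine Finset.sum_congr rfl fun j _ => ?_
    rw [ContinuousLinearMap.star_eq_adjoint, ContinuousLinearMap.adjoint_inner_left, inner_re_symm]
  have eX : X.arveson.amp a = matrixOp (Matrix.of fun i j =>
      (x i j : X.H →L[𝕜] X.H) + star (y i j : X.H →L[𝕜] X.H)) := by
    refine congrArg matrixOp ?_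
    ext i j : 2
    rw [Matrix.map_apply, hxy]
    rfl
  have eY : Y.arveson.amp (a.map (arvesonHom f h1 hf)) = matrixOp (Matrix.of fun i j =>
      (f (x i j) : Y.H →L[𝕜] Y.H) + star (f (y i j) : Y.H →L[𝕜] Y.H)) := by
    refine congrArg matrixOp ?_
    ext i j : 2
    rw [Matrix.map_apply, Matrix.map_apply, hxy, arvesonHom_mk]
    rfl
  rw [eX] at ha
  rw [eY]
  refine ⟨?_, fun η => ?_⟩
  · have hs := (isSymmetric_matrixOp_iff _).1 ha.1
    refine (isSymmetric_matrixOp_iff _).2 fun i j => ?_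
    have hij := hs i j
    simp only [Matrix.of_apply, star_add, star_star] at hij ⊢
    have h0 := map_add_star_eq_zero f h1 hf (y i j - x j i) (x i j - y j i) (by
      rw [Submodule.coe_sub, Submodule.coe_sub, star_sub]
      rw [sub_add_sub_comm, add_comm (y i j : X.H →L[𝕜] X.H), hij, sub_self])
    rw [map_sub, map_sub, Submodule.coe_sub, Submodule.coe_sub, star_sub, sub_add_sub_comm,
      sub_eq_zero] at h0
    rw [← h0, add_comm]
  · refine (accretive_map f h1 hf (Matrix.of fun i j => x i j + y j i) (fun ξ => ?_) η).trans_eq ?_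
    · rw [← form]
      exact ha.2 ξ
    · refine Eq.trans ?_ (form Y (fun i j => f (x i j)) (fun i j => f (y i j)) η).symm
      congr 4
      ext i j : 2
      simp

end Arveson

section ArvesonFunctor

variable {𝕜₁ : Type} [RCLike 𝕜₁]

/-- The additive map underlying the action of `g` on a unital `G`-operator space. -/
def GUnitalOperatorSpace.actionHom {G : Type v} [Group G] (X : GUnitalOperatorSpace.{u} 𝕜₁ G)
    (g : G) : X.space →+ X.space :=
  (X.action g : X.space →ₗ[𝕜₁] X.space).toAddMonoidHom

theorem GUnitalOperatorSpace.actionHom_contractive {G : Type v} [Group G]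
    (X : GUnitalOperatorSpace.{u} 𝕜₁ G) (g : G) :
    IsCompletelyContractive (X := X.toOperatorSpace) (Y := X.toOperatorSpace) (X.actionHom g) :=
  fun n a => (X.action_isometric g n a).le

/-- The map `x + y⋆ ↦ g x + (g y)⋆` on `X + X⋆`. -/
def GUnitalOperatorSpace.arvesonActionHom {G : Type v} [Group G]
    (X : GUnitalOperatorSpace.{u} 𝕜₁ G) (g : G) :
    X.arveson.space →+ X.arveson.space :=
  arvesonHom (X.actionHom g) (X.action_unit g) (X.actionHom_contractive g)

theorem GUnitalOperatorSpace.arvesonActionHom_mk {G : Type v} [Group G]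
    (X : GUnitalOperatorSpace.{u} 𝕜₁ G) (g : G) (x y : X.space) :
    X.arvesonActionHom g (addStarMk x y) = addStarMk (X.action g x) (X.action g y) :=
  arvesonHom_mk _ _ _ x y

theorem GUnitalOperatorSpace.arvesonActionHom_one {G : Type v} [Group G]
    (X : GUnitalOperatorSpace.{u} 𝕜₁ G) (z : X.arveson.space) :
    X.arvesonActionHom 1 z = z := by
  obtain ⟨x, y, rfl⟩ := exists_mk z
  rw [arvesonActionHom_mk, map_one]
  rfl

theorem GUnitalOperatorSpace.arvesonActionHom_mul {G : Type v} [Group G]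
    (X : GUnitalOperatorSpace.{u} 𝕜₁ G) (g h : G) (z : X.arveson.space) :
    X.arvesonActionHom (g * h) z = X.arvesonActionHom g (X.arvesonActionHom h z) := by
  obtain ⟨x, y, rfl⟩ := exists_mk z
  rw [arvesonActionHom_mk, arvesonActionHom_mk, arvesonActionHom_mk, map_mul]
  rfl

/-- The `G`-operator system `X + X⋆`, with the action `g (x + y⋆) = g x + (g y)⋆`. -/
def GUnitalOperatorSpace.arvesonG {G : Type v} [Group G]
    (X : GUnitalOperatorSpace.{u} 𝕜₁ G) : GOperatorSystem.{u} 𝕜₁ G where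
  toOperatorSystem := X.arveson
  action :=
    { toFun := fun g =>
        { toFun := X.arvesonActionHom g
          map_add' := map_add _
          map_smul' := fun c z => arvesonHom_smul _ _ _ c
            (fun x => (X.action g).map_smul c x) (fun x => (X.action g).map_smul _ x) z
          invFun := X.arvesonActionHom g⁻¹
          left_inv := fun z => by
            rw [← X.arvesonActionHom_mul, inv_mul_cancel, X.arvesonActionHom_one]
          right_inv := fun z => by
            rw [← X.arvesonActionHom_mul, mul_inv_cancel, X.arvesonActionHom_one] }
      map_one' := LinearEquiv.ext X.arvesonActionHom_one
      map_mul' := fun g h => LinearEquiv.ext (X.arvesonActionHom_mul g h) }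
  action_unit g := arvesonHom_unit _ (X.action_unit g) (X.actionHom_contractive g)
  action_order g n a := by
    refine ⟨fun h => arvesonHom_positive _ (X.action_unit g) (X.actionHom_contractive g) n a h,
      fun h => ?_⟩
    have h' := arvesonHom_positive _ (X.action_unit g⁻¹) (X.actionHom_contractive g⁻¹) n _ h
    have e : (a.map (X.arvesonActionHom g)).map (X.arvesonActionHom g⁻¹) = a := by
      ext i j : 2
      rw [Matrix.map_apply, Matrix.map_apply, ← X.arvesonActionHom_mul, inv_mul_cancel,
        X.arvesonActionHom_one]
    exact e ▸ h'

variable (𝕜₂ : Type) [RCLike 𝕜₂] [Algebra 𝕜₂ 𝕜₁] [StarModule 𝕜₂ 𝕜₁]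

variable {𝕜₂} in
/-- The unital completely positive map `x + y⋆ ↦ f x + (f y)⋆` from `X + X⋆` to `Y + Y⋆`. -/
def UCCMap.arveson {X Y : UnitalOperatorSpace.{u} 𝕜₁} (f : UCCMap 𝕜₂ X Y) :
    UCPMap 𝕜₂ X.arveson Y.arveson where
  toFun := arvesonHom f.toFun f.map_unit f.contractive
  map_smul c z := arvesonHom_smul _ _ _ _ (f.map_smul c)
    (fun x => by rw [← algebraMap_star_comm]; exact f.map_smul _ x) z
  map_unit := arvesonHom_unit _ _ _
  positive := arvesonHom_positive _ _ _

variable {𝕜₂} in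
theorem UCCMap.arveson_mk {X Y : UnitalOperatorSpace.{u} 𝕜₁} (f : UCCMap 𝕜₂ X Y)
    (x y : X.space) : f.arveson.toFun (addStarMk x y) = addStarMk (f.toFun x) (f.toFun y) :=
  arvesonHom_mk _ f.map_unit f.contractive x y

theorem UCCMap.arveson_id (X : UnitalOperatorSpace.{u} 𝕜₁) :
    (UCCMap.id X : UCCMap 𝕜₂ X X).arveson = UCPMap.id X.arveson := by
  refine UCPMap.ext (AddMonoidHom.ext fun z => ?_)
  obtain ⟨x, y, rfl⟩ := exists_mk z
  exact UCCMap.arveson_mk _ x y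

variable {𝕜₂} in
theorem UCCMap.arveson_comp {X Y Z : UnitalOperatorSpace.{u} 𝕜₁} (f : UCCMap 𝕜₂ X Y)
    (g : UCCMap 𝕜₂ Y Z) : (f.comp g).arveson = f.arveson.comp g.arveson := by
  refine UCPMap.ext (AddMonoidHom.ext fun z => ?_)
  obtain ⟨x, y, rfl⟩ := exists_mk z
  refine (UCCMap.arveson_mk _ x y).trans ?_
  refine Eq.trans ?_ (congrArg g.arveson.toFun (UCCMap.arveson_mk f x y)).symm
  exact (UCCMap.arveson_mk g _ _).symm

variable {𝕜₂} in
/-- The equivariant version of `UCCMap.arveson`. -/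
def GUCCMap.arvesonG {G : Type v} [Group G] {X Y : GUnitalOperatorSpace.{u} 𝕜₁ G}
    (f : GUCCMap 𝕜₂ X Y) : GUCPMap 𝕜₂ X.arvesonG Y.arvesonG where
  toUCPMap := f.toUCCMap.arveson
  equivariant g z := by
    obtain ⟨x, y, rfl⟩ := exists_mk (X := X.toUnitalOperatorSpace) z
    refine (congrArg f.toUCCMap.arveson.toFun (X.arvesonActionHom_mk g x y)).trans ?_
    refine Eq.trans ?_ (congrArg (Y.arvesonActionHom g) (f.toUCCMap.arveson_mk x y)).symm
    rw [UCCMap.arveson_mk, f.equivariant, f.equivariant, Y.arvesonActionHom_mk]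

variable (𝕜₁)

/-- The Arveson functor `X ↦ X + X⋆`, `f ↦ (x + y⋆ ↦ f x + (f y)⋆)`, from unital
`𝕜₁`-operator spaces to `𝕜₁`-operator systems, with `𝕜₂`-linear morphisms. -/
def arvesonFunctor : OSpOne.{u} 𝕜₁ 𝕜₂ ⥤ OSy.{u} 𝕜₁ 𝕜₂ where
  obj X := UnitalOperatorSpace.arveson X
  map f := UCCMap.arveson f
  map_id X := UCCMap.arveson_id 𝕜₂ X
  map_comp f g := UCCMap.arveson_comp f g

/-- The Arveson functor between the `G`-equivariant categories; `X + X⋆` carries the action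
`g (x + y⋆) = g x + (g y)⋆`. -/
def arvesonFunctorG (G : Type v) [Group G] : OSpOneG.{u} 𝕜₁ 𝕜₂ G ⥤ OSyG.{u} 𝕜₁ 𝕜₂ G where
  obj X := GUnitalOperatorSpace.arvesonG X
  map f := GUCCMap.arvesonG f
  map_id X := GUCPMap.ext (congrArg UCPMap.toFun (UCCMap.arveson_id 𝕜₂ X.toUnitalOperatorSpace))
  map_comp f g := GUCPMap.ext
    (congrArg UCPMap.toFun (UCCMap.arveson_comp f.toUCCMap g.toUCCMap))

end ArvesonFunctor

section Triangular

variable (𝕜 : Type) [RCLike 𝕜]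

/-- The upper triangular matrices in `M_2(𝕜)`. -/
def upperTriangular : Submodule 𝕜 (Matrix (Fin 2) (Fin 2) 𝕜) where
  carrier := {A | A 1 0 = 0}
  zero_mem' := rfl
  add_mem' {A B} hA hB := by
    have hA' : A 1 0 = 0 := hA
    have hB' : B 1 0 = 0 := hB
    show A 1 0 + B 1 0 = 0
    rw [hA', hB', add_zero]
  smul_mem' c A hA := by
    have hA' : A 1 0 = 0 := hA
    show c • A 1 0 = 0
    rw [hA', smul_zero]

/-- The unital operator space `T_2` of upper triangular matrices, acting on `𝕜²`. -/
def triangular : UnitalOperatorSpace.{0} 𝕜 where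
  H := EuclideanSpace 𝕜 (Fin 2)
  space := (upperTriangular 𝕜).map
    (Matrix.toEuclideanCLM (n := Fin 2) (𝕜 := 𝕜)).toAlgEquiv.toLinearMap
  one_mem := ⟨1, Matrix.one_apply_ne (by decide),
    map_one (Matrix.toEuclideanCLM (n := Fin 2) (𝕜 := 𝕜))⟩

/-- A unital operator space with the trivial action of `G`. -/
def UnitalOperatorSpace.trivialAction {𝕜 : Type} [RCLike 𝕜] (X : UnitalOperatorSpace.{u} 𝕜)
    (G : Type v) [Group G] : GUnitalOperatorSpace.{u} 𝕜 G where
  toUnitalOperatorSpace := X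
  action := 1
  action_unit _ := rfl
  action_isometric _ _ _ := rfl

/-- The flip `A ↦ S A S` of `M_2(𝕜)`, where `S` is the permutation matrix that exchanges the two
basis vectors, as a `⋆`-automorphism. -/
def flipAut : Matrix (Fin 2) (Fin 2) 𝕜 ≃⋆ₐ[𝕜] Matrix (Fin 2) (Fin 2) 𝕜 :=
  Unitary.conjStarAlgAut 𝕜 _ ⟨!![0, 1; 1, 0], by
    rw [Unitary.mem_iff, Matrix.star_eq_conjTranspose]
    constructor <;>
    · ext i j
      fin_cases i <;> fin_cases j <;> simp [Matrix.mul_apply, Fin.sum_univ_two]⟩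

theorem flipAut_apply (A : Matrix (Fin 2) (Fin 2) 𝕜) :
    flipAut 𝕜 A = !![A 1 1, A 1 0; A 0 1, A 0 0] := by
  rw [flipAut, Unitary.conjStarAlgAut_apply]
  ext i j
  fin_cases i <;> fin_cases j <;>
    simp [Matrix.mul_apply, Fin.sum_univ_two, Matrix.star_eq_conjTranspose,
      Matrix.vecMul, dotProduct]

variable {𝕜} in
/-- The endomorphism `g` of the operator system `T_2 + T_2⋆` is the restriction of the flip,
under the identification `M_2(𝕜) = B(𝕜²)`. -/
def IsFlip {𝕜₂ : Type} [RCLike 𝕜₂] [Algebra 𝕜₂ 𝕜]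
    (g : UCPMap 𝕜₂ (triangular 𝕜).arveson (triangular 𝕜).arveson) : Prop :=
  ∀ (A : Matrix (Fin 2) (Fin 2) 𝕜)
    (hA : Matrix.toEuclideanCLM (n := Fin 2) (𝕜 := 𝕜) A ∈ (triangular 𝕜).addStar),
    (g.toFun ⟨Matrix.toEuclideanCLM (n := Fin 2) (𝕜 := 𝕜) A, hA⟩).1 =
      Matrix.toEuclideanCLM (n := Fin 2) (𝕜 := 𝕜) (flipAut 𝕜 A)

end Triangular

end OperatorCat

end

open OperatorCat

/-!
The extension `ũ` restricts to `u` on `X`, so the functor is faithful. An operator system `S` is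
itself a unital operator space with `S + S⋆ = S`, which gives essential surjectivity; in the
equivariant case the action must moreover be shown to be completely isometric, and this holds
because `‖a‖ ≤ c` if and only if `[[c, a], [a⋆, c]]` is positive, so that a unital complete order
embedding determines the norms of matrices. Finally `F_A(f)` maps `T_2` into `T_2`, while
conjugation by the swap unitary is completely positive and does not, so the functor is not full.
-/

noncomputable section

namespace OperatorCat

section Faithful

variable {𝕜₁ 𝕜₂ : Type} [RCLike 𝕜₁] [RCLike 𝕜₂] [Algebra 𝕜₂ 𝕜₁] [StarModule 𝕜₂ 𝕜₁]

theorem UCCMap.coe_arveson_mk_zero {X Y : UnitalOperatorSpace.{u} 𝕜₁} (f : UCCMap 𝕜₂ X Y)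
    (x : X.space) :
    ((f.arveson.toFun (addStarMk x 0)).1 : Y.H →L[𝕜₁] Y.H) = (f.toFun x).1 := by
  rw [UCCMap.arveson_mk, map_zero]
  exact (congrArg _ (star_zero _)).trans (add_zero _)

theorem UCCMap.arveson_injective {X Y : UnitalOperatorSpace.{u} 𝕜₁} :
    Function.Injective (UCCMap.arveson : UCCMap 𝕜₂ X Y → UCPMap 𝕜₂ X.arveson Y.arveson) := by
  intro f g h
  ext x : 3
  rw [← f.coe_arveson_mk_zero, ← g.coe_arveson_mk_zero, h]

theorem GUCCMap.arvesonG_injective {G : Type v} [Group G] {X Y : GUnitalOperatorSpace.{u} 𝕜₁ G} :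
    Function.Injective (GUCCMap.arvesonG : GUCCMap 𝕜₂ X Y → GUCPMap 𝕜₂ X.arvesonG Y.arvesonG) :=
  fun _ _ h => GUCCMap.ext
    (congrArg UCCMap.toFun (UCCMap.arveson_injective (congrArg GUCPMap.toUCPMap h)))

theorem arvesonFunctor_faithful : (arvesonFunctor.{u} 𝕜₁ 𝕜₂).Faithful where
  map_injective h := UCCMap.arveson_injective h

theorem arvesonFunctorG_faithful (G : Type v) [Group G] :
    (arvesonFunctorG.{u, v} 𝕜₁ 𝕜₂ G).Faithful where
  map_injective h := GUCCMap.arvesonG_injective h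

end Faithful

section PaulsenMatrix

/-- The `2n × 2n` matrix `[[e, a], [a⋆, e]]`, where the diagonal blocks are `e` times the identity
matrix. With `e` a multiple of the unit, its positivity encodes a bound on the norm of `a`. -/
def paulsenMatrix {A : Type*} [Zero A] [Star A] {n : ℕ} (e : A) (a : Matrix (Fin n) (Fin n) A) :
    Matrix (Fin (n + n)) (Fin (n + n)) A :=
  (Matrix.fromBlocks (Matrix.diagonal fun _ => e) a a.conjTranspose
    (Matrix.diagonal fun _ => e)).reindex finSumFinEquiv finSumFinEquiv

theorem paulsenMatrix_map {A B : Type*} [Zero A] [Star A] [Zero B] [Star B] {f : A → B}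
    (f_zero : f 0 = 0) (f_star : ∀ x, f (star x) = star (f x)) {n : ℕ} (e : A)
    (a : Matrix (Fin n) (Fin n) A) :
    (paulsenMatrix e a).map f = paulsenMatrix (f e) (a.map f) := by
  rw [paulsenMatrix, Matrix.reindex_apply, ← Matrix.submatrix_map, Matrix.fromBlocks_map,
    Matrix.diagonal_map f_zero, Matrix.conjTranspose_map f f_star]
  rfl

theorem isHermitian_paulsenMatrix {A : Type*} [AddMonoid A] [StarAddMonoid A] {n : ℕ} {e : A}
    (he : IsSelfAdjoint e) (a : Matrix (Fin n) (Fin n) A) : (paulsenMatrix e a).IsHermitian := by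
  have hdiag : (Matrix.diagonal fun _ : Fin n => e).IsHermitian :=
    Matrix.isHermitian_diagonal_of_self_adjoint _ (funext fun _ => he)
  exact (hdiag.fromBlocks rfl hdiag).submatrix _

end PaulsenMatrix

section NormPositivity

variable {𝕜 : Type} [RCLike 𝕜]

theorem norm_le_iff_forall_re_inner {E F : Type*} [NormedAddCommGroup E] [InnerProductSpace 𝕜 E]
    [NormedAddCommGroup F] [InnerProductSpace 𝕜 F] (A : E →L[𝕜] F) {c : ℝ} (hc : 0 ≤ c) :
    ‖A‖ ≤ c ↔ ∀ ξ η, 0 ≤ c * (‖η‖ ^ 2 + ‖ξ‖ ^ 2) + 2 * RCLike.re (inner 𝕜 (A ξ) η) := by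
  constructor
  · intro hA ξ η
    have cauchy_schwarz : |RCLike.re (inner 𝕜 (A ξ) η)| ≤ c * ‖ξ‖ * ‖η‖ :=
      calc |RCLike.re (inner 𝕜 (A ξ) η)| ≤ ‖A ξ‖ * ‖η‖ :=
            (RCLike.abs_re_le_norm _).trans (norm_inner_le_norm _ _)
        _ ≤ c * ‖ξ‖ * ‖η‖ := by gcongr; exact A.le_of_opNorm_le hA ξ
    nlinarith [(abs_le.1 cauchy_schwarz).1, mul_nonneg hc (sq_nonneg (‖η‖ - ‖ξ‖))]
  · intro h
    refine ContinuousLinearMap.opNorm_le_of_re_inner_le hc fun ξ η hξ hη => ?_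
    have := h ξ (-η)
    rw [inner_neg_right, map_neg, norm_neg, hξ, hη] at this
    linarith

variable {H : Type u} [NormedAddCommGroup H] [InnerProductSpace 𝕜 H] {n : ℕ}

theorem matrixOp_diagonal_smul_one (c : 𝕜) :
    matrixOp (Matrix.diagonal fun _ : Fin n => c • (1 : H →L[𝕜] H)) = c • 1 := by
  ext ξ i
  rw [matrixOp_apply, Finset.sum_eq_single_of_mem i (Finset.mem_univ i)]
  · rw [Matrix.diagonal_apply_eq]
    rfl
  · intro j _ hj
    rw [Matrix.diagonal_apply_ne' _ hj, zero_apply]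

theorem inner_matrixOp_fromBlocks (p q r s : Matrix (Fin n) (Fin n) (H →L[𝕜] H))
    (ζ η : PiLp 2 (fun _ : Fin n => H)) :
    inner 𝕜 (matrixOp ((Matrix.fromBlocks p q r s).reindex finSumFinEquiv finSumFinEquiv)
        (WithLp.toLp 2 (Fin.append ζ η))) (WithLp.toLp 2 (Fin.append ζ η)) =
      inner 𝕜 (matrixOp p ζ) ζ + inner 𝕜 (matrixOp q η) ζ +
        (inner 𝕜 (matrixOp r ζ) η + inner 𝕜 (matrixOp s η) η) := by
  simp only [inner_matrixOp, Matrix.reindex_apply, Matrix.submatrix_apply, Fin.sum_univ_add,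
    finSumFinEquiv_symm_apply_castAdd, finSumFinEquiv_symm_apply_natAdd, Fin.append_left,
    Fin.append_right, Matrix.fromBlocks_apply₁₁, Matrix.fromBlocks_apply₁₂,
    Matrix.fromBlocks_apply₂₁, Matrix.fromBlocks_apply₂₂, Finset.sum_add_distrib]
  exact add_add_add_comm _ _ _ _

variable [CompleteSpace H]

theorem isSymmetric_matrixOp_iff_isHermitian (a : Matrix (Fin n) (Fin n) (H →L[𝕜] H)) :
    (matrixOp a).IsSymmetric ↔ a.IsHermitian := by
  rw [isSymmetric_matrixOp_iff, Matrix.IsHermitian.ext_iff, forall_comm]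

theorem matrixOp_conjTranspose (a : Matrix (Fin n) (Fin n) (H →L[𝕜] H)) :
    matrixOp a.conjTranspose = (matrixOp a).adjoint := by
  refine (ContinuousLinearMap.eq_adjoint_iff _ _).2 fun ξ η => ?_
  rw [← inner_conj_symm ξ, inner_matrixOp, inner_matrixOp, Finset.sum_comm, map_sum]
  simp only [map_sum, inner_conj_symm, Matrix.conjTranspose_apply,
    ContinuousLinearMap.star_eq_adjoint, ContinuousLinearMap.adjoint_inner_left]

theorem re_inner_matrixOp_paulsenMatrix (c : ℝ) (a : Matrix (Fin n) (Fin n) (H →L[𝕜] H))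
    (ζ η : PiLp 2 (fun _ : Fin n => H)) :
    RCLike.re (inner 𝕜 (matrixOp (paulsenMatrix ((c : 𝕜) • 1) a) (WithLp.toLp 2 (Fin.append ζ η)))
        (WithLp.toLp 2 (Fin.append ζ η))) =
      c * (‖ζ‖ ^ 2 + ‖η‖ ^ 2) + 2 * RCLike.re (inner 𝕜 (matrixOp a η) ζ) := by
  have inner_scalar (θ : PiLp 2 (fun _ : Fin n => H)) :
      RCLike.re (inner 𝕜 (((c : 𝕜) • 1 : _ →L[𝕜] _) θ) θ) = c * ‖θ‖ ^ 2 := by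
    rw [smul_apply, one_apply_eq_self, inner_smul_left, RCLike.conj_ofReal,
      RCLike.re_ofReal_mul, inner_self_eq_norm_sq]
  rw [paulsenMatrix, inner_matrixOp_fromBlocks, matrixOp_diagonal_smul_one, matrixOp_conjTranspose,
    ContinuousLinearMap.adjoint_inner_left, map_add, map_add, map_add, inner_scalar, inner_scalar,
    inner_re_symm ζ]
  ring

theorem isPositive_matrixOp_paulsenMatrix_iff {c : ℝ} (hc : 0 ≤ c)
    (a : Matrix (Fin n) (Fin n) (H →L[𝕜] H)) :
    (matrixOp (paulsenMatrix ((c : 𝕜) • 1) a)).IsPositive ↔ ‖matrixOp a‖ ≤ c := by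
  have isSelfAdjoint_scalar : IsSelfAdjoint ((c : 𝕜) • (1 : H →L[𝕜] H)) := by
    rw [isSelfAdjoint_iff, star_smul, star_one, RCLike.star_def, RCLike.conj_ofReal]
  have isSymmetric := (isSymmetric_matrixOp_iff_isHermitian _).2
    (isHermitian_paulsenMatrix isSelfAdjoint_scalar a)
  rw [norm_le_iff_forall_re_inner _ hc]
  refine ⟨fun h η ζ => ?_, fun h => ⟨isSymmetric, fun ξ => ?_⟩⟩
  · rw [← re_inner_matrixOp_paulsenMatrix]
    exact h.2 _
  · have h_append := h (WithLp.toLp 2 fun i => ξ (Fin.natAdd n i))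
      (WithLp.toLp 2 fun i => ξ (Fin.castAdd n i))
    rw [← re_inner_matrixOp_paulsenMatrix, Fin.append_castAdd_natAdd] at h_append
    exact h_append

end NormPositivity

section CompleteOrderEmbedding

variable {𝕜 : Type} [RCLike 𝕜]

instance (S : OperatorSystem.{u} 𝕜) : Star S.space :=
  ⟨fun x => ⟨star x.1, S.star_mem x.1 x.2⟩⟩

theorem OperatorSystem.isPositive_amp_paulsenMatrix_iff (S : OperatorSystem.{u} 𝕜) {c : ℝ}
    (hc : 0 ≤ c) {n : ℕ} (a : Matrix (Fin n) (Fin n) S.space) :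
    (S.amp (paulsenMatrix ((c : 𝕜) • S.unit) a)).IsPositive ↔ ‖S.amp a‖ ≤ c := by
  rw [OperatorSpace.amp, paulsenMatrix_map Submodule.coe_zero fun _ => rfl]
  exact isPositive_matrixOp_paulsenMatrix_iff hc _

variable {S T : OperatorSystem.{u} 𝕜} {f : S.space → T.space}

theorem IsCompletelyPositive.map_star
    (hf : IsCompletelyPositive (X := S.toOperatorSpace) (Y := T.toOperatorSpace) f) (x : S.space) :
    f (star x) = star (f x) := by
  -- `[[‖x‖, x], [x⋆, ‖x‖]]` is positive, so its image is Hermitian, whatever the diagonal maps to.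
  let a : Matrix (Fin 1) (Fin 1) S.space := Matrix.of fun _ _ => x
  have image_isPositive :=
    hf _ _ ((S.isPositive_amp_paulsenMatrix_iff (norm_nonneg (S.amp a)) a).2 le_rfl)
  have off_diagonal := (isSymmetric_matrixOp_iff _).1 image_isPositive.1
    (Fin.castAdd 1 0) (Fin.natAdd 1 0)
  simp only [paulsenMatrix, Matrix.map_apply, Matrix.reindex_apply, Matrix.submatrix_apply,
    finSumFinEquiv_symm_apply_castAdd, finSumFinEquiv_symm_apply_natAdd,
    Matrix.fromBlocks_apply₁₂, Matrix.fromBlocks_apply₂₁, Matrix.conjTranspose_apply,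
    a, Matrix.of_apply] at off_diagonal
  exact Subtype.ext off_diagonal.symm

theorem IsCompleteOrderEmbedding.isCompletelyIsometric
    (hf : IsCompleteOrderEmbedding (X := S.toOperatorSpace) (Y := T.toOperatorSpace) f)
    (map_smul_unit : ∀ c : ℝ, f ((c : 𝕜) • S.unit) = (c : 𝕜) • T.unit) :
    IsCompletelyIsometric (X := S.toOperatorSpace) (Y := T.toOperatorSpace) f := by
  intro n a
  have map_zero : f 0 = 0 := by simpa using map_smul_unit 0
  have map_star : ∀ x, f (star x) = star (f x) :=
    IsCompletelyPositive.map_star fun n a => (hf n a).1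
  have norm_le_iff {c : ℝ} (hc : 0 ≤ c) : ‖T.amp (a.map f)‖ ≤ c ↔ ‖S.amp a‖ ≤ c := by
    rw [← T.isPositive_amp_paulsenMatrix_iff hc, ← S.isPositive_amp_paulsenMatrix_iff hc,
      hf, paulsenMatrix_map map_zero map_star, map_smul_unit]
  exact le_antisymm ((norm_le_iff (norm_nonneg _)).2 le_rfl)
    ((norm_le_iff (norm_nonneg _)).1 le_rfl)

end CompleteOrderEmbedding

section EssSurj

variable {𝕜₁ : Type} [RCLike 𝕜₁]

theorem OperatorSystem.addStar_eq_space (S : OperatorSystem.{u} 𝕜₁) : S.addStar = S.space := by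
  refine le_antisymm ?_ fun x hx => ⟨x, hx, 0, S.space.zero_mem, by simp⟩
  rintro _ ⟨x, hx, y, hy, rfl⟩
  exact S.space.add_mem hx (S.star_mem y hy)

section Morphisms

variable (𝕜₂ : Type) [RCLike 𝕜₂] [Algebra 𝕜₂ 𝕜₁]

/-- The identity of an operator system `S`, as a morphism from `S + S⋆` to `S`. -/
def OperatorSystem.ofArveson (S : OperatorSystem.{u} 𝕜₁) : UCPMap 𝕜₂ S.arveson S where
  toFun := (Submodule.inclusion S.addStar_eq_space.le).toAddMonoidHom
  map_smul _ _ := rfl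
  map_unit := rfl
  positive _ _ h := h

/-- The identity of an operator system `S`, as a morphism from `S` to `S + S⋆`. -/
def OperatorSystem.toArveson (S : OperatorSystem.{u} 𝕜₁) : UCPMap 𝕜₂ S S.arveson where
  toFun := (Submodule.inclusion S.addStar_eq_space.ge).toAddMonoidHom
  map_smul _ _ := rfl
  map_unit := rfl
  positive _ _ h := h

theorem OperatorSystem.toArveson_apply (S : OperatorSystem.{u} 𝕜₁) (x : S.space) :
    (S.toArveson 𝕜₂).toFun x = addStarMk x 0 :=
  Subtype.ext ((congrArg (x.1 + ·) (star_zero (S.H →L[𝕜₁] S.H))).trans (add_zero x.1)).symm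

end Morphisms

variable {G : Type v} [Group G]

/-- A `G`-operator system, as a unital `G`-operator space. -/
def GOperatorSystem.toGUnitalOperatorSpace (S : GOperatorSystem.{u} 𝕜₁ G) :
    GUnitalOperatorSpace.{u} 𝕜₁ G where
  toUnitalOperatorSpace := S.toUnitalOperatorSpace
  action := S.action
  action_unit := S.action_unit
  action_isometric g :=
    IsCompleteOrderEmbedding.isCompletelyIsometric (S := S.toOperatorSystem)
      (T := S.toOperatorSystem) (S.action_order g) fun c => by rw [map_smul, S.action_unit]

variable (𝕜₂ : Type) [RCLike 𝕜₂] [Algebra 𝕜₂ 𝕜₁]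

theorem GOperatorSystem.toArveson_action (S : GOperatorSystem.{u} 𝕜₁ G) (g : G) (x : S.space) :
    (S.toArveson 𝕜₂).toFun (S.action g x) =
      S.toGUnitalOperatorSpace.arvesonG.action g ((S.toArveson 𝕜₂).toFun x) := by
  rw [OperatorSystem.toArveson_apply 𝕜₂, OperatorSystem.toArveson_apply 𝕜₂]
  exact (congrArg (addStarMk (S.action g x)) (S.action g).map_zero.symm).trans
    (S.toGUnitalOperatorSpace.arvesonActionHom_mk g x 0).symm

/-- `OperatorSystem.ofArveson` for a `G`-operator system. -/
def GOperatorSystem.ofArvesonG (S : GOperatorSystem.{u} 𝕜₁ G) :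
    GUCPMap 𝕜₂ S.toGUnitalOperatorSpace.arvesonG S where
  toUCPMap := S.ofArveson 𝕜₂
  equivariant g z := congrArg (S.ofArveson 𝕜₂).toFun
    (S.toArveson_action 𝕜₂ g ((S.ofArveson 𝕜₂).toFun z)).symm

/-- `OperatorSystem.toArveson` for a `G`-operator system. -/
def GOperatorSystem.toArvesonG (S : GOperatorSystem.{u} 𝕜₁ G) :
    GUCPMap 𝕜₂ S S.toGUnitalOperatorSpace.arvesonG where
  toUCPMap := S.toArveson 𝕜₂
  equivariant := S.toArveson_action 𝕜₂

variable {𝕜₂} [StarModule 𝕜₂ 𝕜₁]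

theorem arvesonFunctor_essSurj : (arvesonFunctor.{u} 𝕜₁ 𝕜₂).EssSurj where
  mem_essImage (S : OperatorSystem.{u} 𝕜₁) :=
    ⟨S.toUnitalOperatorSpace,
      ⟨{ hom := S.ofArveson 𝕜₂, inv := S.toArveson 𝕜₂, hom_inv_id := rfl, inv_hom_id := rfl }⟩⟩

theorem arvesonFunctorG_essSurj (G : Type v) [Group G] :
    (arvesonFunctorG.{u, v} 𝕜₁ 𝕜₂ G).EssSurj where
  mem_essImage (S : GOperatorSystem.{u} 𝕜₁ G) :=
    ⟨S.toGUnitalOperatorSpace,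
      ⟨{ hom := S.ofArvesonG 𝕜₂, inv := S.toArvesonG 𝕜₂, hom_inv_id := rfl, inv_hom_id := rfl }⟩⟩

end EssSurj

section Conjugation

variable {𝕜 : Type} [RCLike 𝕜]

theorem isPositive_matrixOp_conj_adjoint {H : Type u} [NormedAddCommGroup H]
    [InnerProductSpace 𝕜 H] [CompleteSpace H] {K : Type v} [NormedAddCommGroup K]
    [InnerProductSpace 𝕜 K] [CompleteSpace K] {n : ℕ} {a : Matrix (Fin n) (Fin n) (H →L[𝕜] H)}
    (ha : (matrixOp a).IsPositive) (V : H →L[𝕜] K) :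
    (matrixOp (a.map fun x => V ∘L x ∘L V.adjoint)).IsPositive := by
  refine ⟨(isSymmetric_matrixOp_iff _).2 fun i j => ?_, fun ξ => ?_⟩
  · have star_entry := (isSymmetric_matrixOp_iff a).1 ha.1 i j
    rw [ContinuousLinearMap.star_eq_adjoint] at star_entry ⊢
    simp only [Matrix.map_apply, ContinuousLinearMap.adjoint_comp,
      ContinuousLinearMap.adjoint_adjoint, star_entry, ContinuousLinearMap.comp_assoc]
  · refine (ha.2 (WithLp.toLp 2 fun i => V.adjoint (ξ i))).trans_eq ?_
    simp only [ContinuousLinearMap.reApplyInnerSelf_apply, inner_matrixOp, Matrix.map_apply,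
      ContinuousLinearMap.comp_apply, ContinuousLinearMap.adjoint_inner_right]

/-- Conjugation by a unitary that maps the operator system `S` into itself, as an endomorphism
of `S`. -/
def OperatorSystem.conjUCP (𝕜₂ : Type) [RCLike 𝕜₂] [Algebra 𝕜₂ 𝕜] (S : OperatorSystem.{u} 𝕜)
    (U : unitary (S.H →L[𝕜] S.H))
    (hS : ∀ x ∈ S.space, Unitary.conjStarAlgAut 𝕜 (S.H →L[𝕜] S.H) U x ∈ S.space) :
    UCPMap 𝕜₂ S S where
  toFun := LinearMap.toAddMonoidHom
    ((Unitary.conjStarAlgAut 𝕜 (S.H →L[𝕜] S.H) U).toAlgEquiv.toLinearMap.restrict hS)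
  map_smul c x := Subtype.ext
    (map_smul (Unitary.conjStarAlgAut 𝕜 (S.H →L[𝕜] S.H) U) (algebraMap 𝕜₂ 𝕜 c) x.1)
  map_unit := Subtype.ext (map_one (Unitary.conjStarAlgAut 𝕜 (S.H →L[𝕜] S.H) U))
  positive _ _ ha := isPositive_matrixOp_conj_adjoint ha U.1

end Conjugation

section TrivialAction

variable {𝕜₁ 𝕜₂ : Type} [RCLike 𝕜₁] [RCLike 𝕜₂] [Algebra 𝕜₂ 𝕜₁] {X Y : UnitalOperatorSpace.{u} 𝕜₁}
  (G : Type v) [Group G]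

theorem trivialAction_arvesonG_action (g : G) (z : X.arveson.space) :
    (X.trivialAction G).arvesonG.action g z = z := by
  obtain ⟨x, y, rfl⟩ := exists_mk z
  exact (X.trivialAction G).arvesonActionHom_mk g x y

/-- A morphism `X + X⋆ → Y + Y⋆` is equivariant for the actions induced by the trivial actions
on `X` and `Y`. -/
def UCPMap.trivialActionG (φ : UCPMap 𝕜₂ X.arveson Y.arveson) :
    GUCPMap 𝕜₂ (X.trivialAction G).arvesonG (Y.trivialAction G).arvesonG where
  toUCPMap := φ
  equivariant g z := (congrArg φ.toFun (trivialAction_arvesonG_action G g z)).trans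
    (trivialAction_arvesonG_action G g (φ.toFun z)).symm

theorem UCPMap.trivialActionG_notMem_range_arvesonG [StarModule 𝕜₂ 𝕜₁]
    {φ : UCPMap 𝕜₂ X.arveson Y.arveson} (hφ : φ ∉ Set.range UCCMap.arveson) :
    φ.trivialActionG G ∉ Set.range GUCCMap.arvesonG := by
  rintro ⟨f, hf⟩
  exact hφ ⟨f.toUCCMap, congrArg GUCPMap.toUCPMap hf⟩

end TrivialAction

section Flip

variable (𝕜 : Type) [RCLike 𝕜]

theorem exists_flipAut_notMem : ∃ A ∈ upperTriangular 𝕜, flipAut 𝕜 A ∉ upperTriangular 𝕜 := by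
  refine ⟨!![0, 1; 0, 0], rfl, fun h => ?_⟩
  have entry_eq_zero : flipAut 𝕜 !![0, 1; 0, 0] 1 0 = 0 := h
  rw [flipAut_apply] at entry_eq_zero
  exact one_ne_zero entry_eq_zero

theorem exists_upperTriangular_add_star (A : Matrix (Fin 2) (Fin 2) 𝕜) :
    ∃ B ∈ upperTriangular 𝕜, ∃ C ∈ upperTriangular 𝕜, A = B + star C := by
  refine ⟨!![A 0 0, A 0 1; 0, A 1 1], rfl, !![0, star (A 1 0); 0, 0], rfl, ?_⟩
  ext i j
  fin_cases i <;> fin_cases j <;> simp [Matrix.star_eq_conjTranspose]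

variable {𝕜} {H : Type u} [NormedAddCommGroup H] [InnerProductSpace 𝕜 H] [CompleteSpace H]
  (Φ : Matrix (Fin 2) (Fin 2) 𝕜 ≃⋆ₐ[𝕜] (H →L[𝕜] H))

/-- The space of upper triangular matrices, acting on `H` through an identification
`Φ : M_2(𝕜) ≅ B(H)`. The operator space `triangular 𝕜` is the case `H = 𝕜²`; a general `H` is
needed to reach every universe. -/
def triangularOn : UnitalOperatorSpace.{u} 𝕜 where
  H := H
  space := (upperTriangular 𝕜).map Φ.toAlgEquiv.toLinearMap
  one_mem := ⟨1, Matrix.one_apply_ne (by decide), map_one Φ⟩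

theorem triangularOn_addStar : (triangularOn Φ).addStar = ⊤ := by
  refine eq_top_iff.2 fun z _ => ?_
  obtain ⟨A, rfl⟩ := EquivLike.surjective Φ z
  obtain ⟨B, hB, C, hC, rfl⟩ := exists_upperTriangular_add_star 𝕜 A
  refine ⟨Φ B, ⟨B, hB, rfl⟩, Φ C, ⟨C, hC, rfl⟩, ?_⟩
  rw [map_add, map_star]
  rfl

variable {𝕜₂ : Type} [RCLike 𝕜₂] [Algebra 𝕜₂ 𝕜]

/-- The endomorphism `φ` of `T_2 + T_2⋆` is the flip, under the identification
`Φ : M_2(𝕜) ≅ B(H)`. The case `H = 𝕜²` is `IsFlip`. -/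
def IsFlipOn (φ : UCPMap 𝕜₂ (triangularOn Φ).arveson (triangularOn Φ).arveson) : Prop :=
  ∀ (A : Matrix (Fin 2) (Fin 2) 𝕜) (hA : Φ A ∈ (triangularOn Φ).addStar),
    (φ.toFun ⟨Φ A, hA⟩).1 = Φ (flipAut 𝕜 A)

theorem exists_isFlipOn :
    ∃ φ : UCPMap 𝕜₂ (triangularOn Φ).arveson (triangularOn Φ).arveson, IsFlipOn Φ φ := by
  obtain ⟨U, hU⟩ : ∃ U, flipAut 𝕜 = Unitary.conjStarAlgAut 𝕜 _ U := ⟨_, rfl⟩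
  let ΦU : unitary (H →L[𝕜] H) := Unitary.map (.ofClass Φ) U
  refine ⟨(triangularOn Φ).arveson.conjUCP 𝕜₂ ΦU fun x _ => ?_, fun A _ => ?_⟩
  · exact (triangularOn_addStar Φ).ge Submodule.mem_top
  · rw [hU, Unitary.conjStarAlgAut_apply, map_mul, map_mul, map_star]
    rfl

variable {Φ} [StarModule 𝕜₂ 𝕜]

theorem IsFlipOn.notMem_range_arveson
    {φ : UCPMap 𝕜₂ (triangularOn Φ).arveson (triangularOn Φ).arveson} (hφ : IsFlipOn Φ φ) :
    φ ∉ Set.range UCCMap.arveson := by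
  rintro ⟨f, rfl⟩
  obtain ⟨A, hA, hflip⟩ := exists_flipAut_notMem 𝕜
  let x : (triangularOn Φ).space := ⟨Φ A, A, hA, rfl⟩
  have hx : addStarMk x 0 = ⟨Φ A, (triangularOn_addStar Φ).ge Submodule.mem_top⟩ :=
    Subtype.ext ((congrArg (Φ A + ·) (star_zero (H →L[𝕜] H))).trans (add_zero (Φ A)))
  have flip_eq : (f.toFun x).1 = Φ (flipAut 𝕜 A) := by
    rw [← f.coe_arveson_mk_zero, hx]
    exact hφ A _
  obtain ⟨B, hB, hΦB⟩ := (f.toFun x).2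
  exact hflip (Φ.injective (hΦB.trans flip_eq) ▸ hB)

variable (Φ)

theorem exists_isFlipOn_notMem_range_arveson :
    ∃ φ : UCPMap 𝕜₂ (triangularOn Φ).arveson (triangularOn Φ).arveson,
      IsFlipOn Φ φ ∧ φ ∉ Set.range UCCMap.arveson :=
  (exists_isFlipOn Φ).imp fun _ hφ => ⟨hφ, hφ.notMem_range_arveson⟩

theorem exists_isFlipOn_notMem_range_arvesonG (G : Type v) [Group G] :
    ∃ φ : GUCPMap 𝕜₂ ((triangularOn Φ).trivialAction G).arvesonG
        ((triangularOn Φ).trivialAction G).arvesonG,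
      IsFlipOn Φ φ.toUCPMap ∧ φ ∉ Set.range GUCCMap.arvesonG := by
  obtain ⟨φ, hφ, hφ_range⟩ := exists_isFlipOn_notMem_range_arveson (𝕜₂ := 𝕜₂) Φ
  exact ⟨φ.trivialActionG G, hφ, UCPMap.trivialActionG_notMem_range_arvesonG G hφ_range⟩

end Flip

section NotFull

variable {𝕜₁ 𝕜₂ : Type} [RCLike 𝕜₁] [RCLike 𝕜₂] [Algebra 𝕜₂ 𝕜₁] [StarModule 𝕜₂ 𝕜₁]

variable (𝕜₁) in
/-- The identification of `M_2(𝕜₁)` with the operators on a two-dimensional Hilbert space in an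
arbitrary universe. -/
def matrixEquivULift : Matrix (Fin 2) (Fin 2) 𝕜₁ ≃⋆ₐ[𝕜₁]
    (EuclideanSpace 𝕜₁ (ULift.{u} (Fin 2)) →L[𝕜₁] EuclideanSpace 𝕜₁ (ULift.{u} (Fin 2))) :=
  (StarAlgEquiv.ofAlgEquiv (Matrix.reindexAlgEquiv 𝕜₁ 𝕜₁ Equiv.ulift.{u}.symm)
    fun _ => rfl).trans Matrix.toEuclideanCLM

theorem arvesonFunctor_not_full : ¬ (arvesonFunctor.{u} 𝕜₁ 𝕜₂).Full := by
  intro full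
  obtain ⟨φ, -, hφ⟩ :=
    exists_isFlipOn_notMem_range_arveson (𝕜₂ := 𝕜₂) (matrixEquivULift.{u} 𝕜₁)
  exact hφ (full.map_surjective φ)

theorem arvesonFunctorG_not_full (G : Type v) [Group G] :
    ¬ (arvesonFunctorG.{u, v} 𝕜₁ 𝕜₂ G).Full := by
  intro full
  obtain ⟨φ, -, hφ⟩ :=
    exists_isFlipOn_notMem_range_arvesonG (𝕜₂ := 𝕜₂) (matrixEquivULift.{u} 𝕜₁) G
  exact hφ (full.map_surjective φ)

end NotFull

section StandardTriangular

variable {𝕜₁ 𝕜₂ : Type} [RCLike 𝕜₁] [RCLike 𝕜₂] [Algebra 𝕜₂ 𝕜₁]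

variable (𝕜₁) in
theorem triangular_addStar : (triangular 𝕜₁).addStar = ⊤ :=
  triangularOn_addStar (Matrix.toEuclideanCLM (n := Fin 2) (𝕜 := 𝕜₁))

variable [StarModule 𝕜₂ 𝕜₁]

theorem exists_isFlip_notMem_range_arveson :
    ∃ φ : UCPMap 𝕜₂ (triangular 𝕜₁).arveson (triangular 𝕜₁).arveson,
      IsFlip φ ∧ φ ∉ Set.range UCCMap.arveson :=
  exists_isFlipOn_notMem_range_arveson (Matrix.toEuclideanCLM (n := Fin 2) (𝕜 := 𝕜₁))

theorem exists_isFlip_notMem_range_arvesonG (G : Type v) [Group G] :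
    ∃ φ : GUCPMap 𝕜₂ ((triangular 𝕜₁).trivialAction G).arvesonG
        ((triangular 𝕜₁).trivialAction G).arvesonG,
      IsFlip φ.toUCPMap ∧ φ ∉ Set.range GUCCMap.arvesonG :=
  exists_isFlipOn_notMem_range_arvesonG (Matrix.toEuclideanCLM (n := Fin 2) (𝕜 := 𝕜₁)) G

end StandardTriangular

end OperatorCat

end

theorem mainTheorem10 (G : Type v) [Group G] :
    ( -- faithful in all six cases
      (arvesonFunctor.{u} ℝ ℝ).Faithful ∧
      (arvesonFunctor.{u} ℂ ℂ).Faithful ∧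
      (arvesonFunctor.{u} ℂ ℝ).Faithful ∧
      (arvesonFunctorG.{u, v} ℝ ℝ G).Faithful ∧
      (arvesonFunctorG.{u, v} ℂ ℂ G).Faithful ∧
      (arvesonFunctorG.{u, v} ℂ ℝ G).Faithful) ∧
    ( -- not full in all six cases
      ¬ (arvesonFunctor.{u} ℝ ℝ).Full ∧
      ¬ (arvesonFunctor.{u} ℂ ℂ).Full ∧
      ¬ (arvesonFunctor.{u} ℂ ℝ).Full ∧
      ¬ (arvesonFunctorG.{u, v} ℝ ℝ G).Full ∧
      ¬ (arvesonFunctorG.{u, v} ℂ ℂ G).Full ∧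
      ¬ (arvesonFunctorG.{u, v} ℂ ℝ G).Full) ∧
    ( -- essentially surjective in all six cases
      (arvesonFunctor.{u} ℝ ℝ).EssSurj ∧
      (arvesonFunctor.{u} ℂ ℂ).EssSurj ∧
      (arvesonFunctor.{u} ℂ ℝ).EssSurj ∧
      (arvesonFunctorG.{u, v} ℝ ℝ G).EssSurj ∧
      (arvesonFunctorG.{u, v} ℂ ℂ G).EssSurj ∧
      (arvesonFunctorG.{u, v} ℂ ℝ G).EssSurj) ∧
    ( -- `M_2 = T_2 + T_2⋆`, and the flip does not map `T_2` into itself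
      (triangular ℝ).addStar = ⊤ ∧
      (triangular ℂ).addStar = ⊤ ∧
      (∃ A ∈ upperTriangular ℝ, flipAut ℝ A ∉ upperTriangular ℝ) ∧
      (∃ A ∈ upperTriangular ℂ, flipAut ℂ A ∉ upperTriangular ℂ)) ∧
    ( -- the flip is a morphism of `T_2 + T_2⋆` outside the image of the functor, in all six cases
      (∃ g : (arvesonFunctor.{0} ℝ ℝ).obj (triangular ℝ) ⟶
          (arvesonFunctor.{0} ℝ ℝ).obj (triangular ℝ),
        IsFlip (𝕜₂ := ℝ) g ∧
          g ∉ Set.range (arvesonFunctor.{0} ℝ ℝ).map) ∧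
      (∃ g : (arvesonFunctor.{0} ℂ ℂ).obj (triangular ℂ) ⟶
          (arvesonFunctor.{0} ℂ ℂ).obj (triangular ℂ),
        IsFlip (𝕜₂ := ℂ) g ∧
          g ∉ Set.range (arvesonFunctor.{0} ℂ ℂ).map) ∧
      (∃ g : (arvesonFunctor.{0} ℂ ℝ).obj (triangular ℂ) ⟶
          (arvesonFunctor.{0} ℂ ℝ).obj (triangular ℂ),
        IsFlip (𝕜₂ := ℝ) g ∧
          g ∉ Set.range (arvesonFunctor.{0} ℂ ℝ).map) ∧
      (∃ g : (arvesonFunctorG.{0, v} ℝ ℝ G).obj ((triangular ℝ).trivialAction G) ⟶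
          (arvesonFunctorG.{0, v} ℝ ℝ G).obj ((triangular ℝ).trivialAction G),
        IsFlip (GUCPMap.toUCPMap (𝕜₂ := ℝ) g) ∧
          g ∉ Set.range (arvesonFunctorG.{0, v} ℝ ℝ G).map) ∧
      (∃ g : (arvesonFunctorG.{0, v} ℂ ℂ G).obj ((triangular ℂ).trivialAction G) ⟶
          (arvesonFunctorG.{0, v} ℂ ℂ G).obj ((triangular ℂ).trivialAction G),
        IsFlip (GUCPMap.toUCPMap (𝕜₂ := ℂ) g) ∧
          g ∉ Set.range (arvesonFunctorG.{0, v} ℂ ℂ G).map) ∧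
      (∃ g : (arvesonFunctorG.{0, v} ℂ ℝ G).obj ((triangular ℂ).trivialAction G) ⟶
          (arvesonFunctorG.{0, v} ℂ ℝ G).obj ((triangular ℂ).trivialAction G),
        IsFlip (GUCPMap.toUCPMap (𝕜₂ := ℝ) g) ∧
          g ∉ Set.range (arvesonFunctorG.{0, v} ℂ ℝ G).map)) := by
  exact
    ⟨⟨arvesonFunctor_faithful, arvesonFunctor_faithful, arvesonFunctor_faithful,
        arvesonFunctorG_faithful G, arvesonFunctorG_faithful G, arvesonFunctorG_faithful G⟩,
      ⟨arvesonFunctor_not_full, arvesonFunctor_not_full, arvesonFunctor_not_full,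
        arvesonFunctorG_not_full G, arvesonFunctorG_not_full G, arvesonFunctorG_not_full G⟩,
      ⟨arvesonFunctor_essSurj, arvesonFunctor_essSurj, arvesonFunctor_essSurj,
        arvesonFunctorG_essSurj G, arvesonFunctorG_essSurj G, arvesonFunctorG_essSurj G⟩,
      ⟨triangular_addStar ℝ, triangular_addStar ℂ,
        exists_flipAut_notMem ℝ, exists_flipAut_notMem ℂ⟩,
      exists_isFlip_notMem_range_arveson,
      exists_isFlip_notMem_range_arveson,
      exists_isFlip_notMem_range_arveson,
      exists_isFlip_notMem_range_arvesonG G,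
      exists_isFlip_notMem_range_arvesonG G,
      exists_isFlip_notMem_range_arvesonG G⟩
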